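/- **Conventions.** A *machine* is a partial recursive function taking a binary program $p$ and a condition $y\in\mathbb N$ to a binary string. A machine $U$ is *universal* if for every machine $V$ there is a constant $c_V$ such that every program $p$ has a program $q$ with $|q|\le |p|+c_V$ and $U(q,y)=V(p,y)$ for all $y$. Fix such a $U$ and let $C(x\mid y)=\min\{|p| : U(p,y)=x\}$. A graph $G$ on the nodes $\{1,\dots,n\}$ is coded by the string $E(G)$ of $n(n-1)/2$ bits that records, in lexicographical order of the pairs $u<v$, which pairs are edges. For $\delta:\mathbb N\to\mathbb R$, $G$ is *$\delta(n)$-random* if $$C(E(G)\mid n,\delta(n))\ \ge\ \tfrac{n(n-1)}2-\delta(n),$$ where $\delta(n)$ is given in the condition through its integer part (taken as $0$ if $\delta(n)<0$). A *routing scheme* for $G$ assigns distinct labels to the nodes, labels the edges at each node $u$ by distinct numbers, and stores a binary string $F(u)$ at each node $u$. A fixed computable function (the *decoder*) determines from $F(u)$, the label of $u$, the increasing list of the labels of the edges at $u$, and the label of a destination $v\ne u$, the label of the edge over which $u$ forwards a message for $v$. It is a *shortest path* routing scheme if for all $u,v$ a message forwarded in this way from $u$ with destination $v$ arrives at $v$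 after exactly $d_G(u,v)$ steps (in particular $G$ is connected). Edge labels follow one of two models: (IB) the edges at $u$ are labeled by ports $1,\dots,\deg u$, by a port assignment that may be chosen together with the scheme; (II) the edge at $u$ leading to $w$ carries the label of $w$. Node labels follow one of three models: ($\alpha$) node $i$ has label $i$; ($\beta$) the labels are a permutation of $1,\dots,n$ that may be chosen; ($\gamma$) the labels are arbitrary distinct natural numbers. The *cost* of $u$ is $|F(u)|$, to which in model $\gamma$ the number of bits of the label of $u$ is added. **Theorem.** For each of the six models (IB or II, combined with $\alpha$, $\beta$ or $\gamma$) there is a computable decoder, depending on the model only, such that for every universal $U$ and every $\delta$ with $\delta(n)=O(\log n)$ the following holds for all sufficiently large $n$: every $\delta(n)$-random labeled graph $G$ on $n$ nodes has a shortest path routing scheme, conforming to the model, in which every node has cost at most $3n$ bits. Hence the total cost of the scheme is at most $3n^2$ bits. -/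

import Mathlib

namespace CompactRouting

/-! ### Conditional Kolmogorov complexity -/

/-- A machine: a partial function taking a binary program and a condition (a natural number) to a
binary string.  Turing machines compute exactly those satisfying `Partrec`. -/
abbrev Machine := List Bool × ℕ →. List Bool

/-- `U` is an (appropriate) universal machine: it is partial recursive, and for every partial
recursive machine `V` it has, for each program `p`, a program `⟨V, p⟩` with
`U (⟨V, p⟩, y) = V (p, y)` for all `y`, which is longer than `p` by at most a constant
depending only on `V`. -/
def IsUniversal (U : Machine) : Prop :=
  Partrec U ∧ ∀ V : Machine, Partrec V →
    ∃ (c : ℕ) (tr : List Bool → List Bool), ∀ p : List Bool,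
      (tr p).length ≤ p.length + c ∧ ∀ y : ℕ, U (tr p, y) = V (p, y)

/-- Kolmogorov complexity `C(x | y)` with respect to `U`: the length of a shortest program with
which `U` produces `x` given `y`.  (For universal `U` such a program always exists.) -/
noncomputable def complexity (U : Machine) (x : List Bool) (y : ℕ) : ℕ :=
  sInf {k | ∃ p : List Bool, p.length = k ∧ x ∈ U (p, y)}

/-- A concrete universal machine: on the program `1ⁱ 0 p` it runs the `i`-th code on `(p, y)`. -/
def stdMachine : Machine := fun a =>
  (Nat.Partrec.Code.eval
      (Denumerable.ofNat Nat.Partrec.Code (a.1.takeWhile id).length)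
      (Encodable.encode ((a.1.dropWhile id).tail, a.2))).bind
    fun m => ((Encodable.decode m : Option (List Bool)) : Part (List Bool))

theorem stdMachine_isUniversal : IsUniversal stdMachine := by
  refine ⟨?_, fun V hV => ?_⟩
  · have h1 : Computable fun a : List Bool × ℕ =>
        Denumerable.ofNat Nat.Partrec.Code (a.1.takeWhile id).length :=
      (Computable.ofNat _).comp ((Primrec.list_length.comp
        ((Primrec.list_takeWhile Primrec.id).comp Primrec.fst)).to_comp)
    have h2 : Computable fun a : List Bool × ℕ =>
        Encodable.encode ((a.1.dropWhile id).tail, a.2) :=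
      (Primrec.encode.comp (Primrec.pair (Primrec.list_tail.comp
        ((Primrec.list_dropWhile Primrec.id).comp Primrec.fst)) Primrec.snd)).to_comp
    refine (Nat.Partrec.Code.eval_part.comp h1 h2).bind ?_
    exact (Computable.ofOption (Computable.decode.comp Computable.snd)).to₂
  · obtain ⟨c, hc⟩ := Nat.Partrec.Code.exists_code.1 hV
    refine ⟨Encodable.encode c + 1,
      fun p => List.replicate (Encodable.encode c) true ++ false :: p, fun p => ⟨?_, fun y => ?_⟩⟩
    · simp only [List.length_append, List.length_replicate, List.length_cons]
      omega
    · have e1 : ((List.replicate (Encodable.encode c) true ++ false :: p).takeWhile id)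
          = List.replicate (Encodable.encode c) true := by
        rw [List.takeWhile_append_of_pos (by simp)]; simp
      have e2 : ((List.replicate (Encodable.encode c) true ++ false :: p).dropWhile id)
          = false :: p := by
        rw [List.dropWhile_append_of_pos (by simp)]; simp
      simp only [stdMachine, e1, e2, List.length_replicate, Denumerable.ofNat_encode, hc,
        List.tail_cons, Encodable.encodek, Part.coe_some, Part.bind_some]
      rw [Part.bind_map]
      simp [Encodable.encodek]

/-! ### Random graphs

The nodes `1, …, n` are represented by `Fin n`, the node `u : Fin n` being number `u + 1`. -/

open Classical in
/-- The code `E(G)`: the `n (n - 1) / 2` possible edges `{u, v}`, `u < v`, are listed in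
lexicographical order, and each contributes the bit telling whether it is present. -/
noncomputable def graphCode {n : ℕ} (G : SimpleGraph (Fin n)) : List Bool :=
  ((List.finRange n ×ˢ List.finRange n).filter fun e => e.1 < e.2).map
    fun e => decide (G.Adj e.1 e.2)

/-- `G` is `δ(n)`-random: `C(E(G) | n, δ) ≥ n (n - 1) / 2 - δ(n)`.  Since `C` is integer valued,
only the integer part of `δ(n)` matters, and this is what is given in the condition; the family of
all labeled graphs on `n` nodes is determined by `n`. -/
def IsRandomGraph (U : Machine) (δ : ℕ → ℝ) {n : ℕ} (G : SimpleGraph (Fin n)) : Prop :=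
  (n : ℝ) * ((n : ℝ) - 1) / 2 - δ n ≤
    (complexity U (graphCode G) (Nat.pair n ⌊δ n⌋₊) : ℝ)

/-! ### Routing schemes -/

/-- What a node knows about its incident edges. -/
inductive EdgeModel
  /-- IB: edges are attached to ports `1, …, deg`, by a port assignment that may be chosen. -/
  | freePorts
  /-- II: an edge carries the label of the node it leads to. -/
  | neighboursKnown

/-- How nodes may be relabeled. -/
inductive LabelModel
  /-- α: no relabeling. -/
  | fixed
  /-- β: relabeling within `1, …, n`. -/
  | permuted
  /-- γ: arbitrary relabeling, label bits being charged. -/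
  | free

/-- A fixed way of interpreting stored bits as a local routing function.  From the bits stored at
a node, the label of the node, the increasing list of the labels of its incident edges, and the
label of a destination, it determines the label of the edge over which to route. -/
abbrev Decoder := List Bool × ℕ × List ℕ × ℕ → ℕ

/-- A routing scheme on `G`: node labels, labels of the edges at each node (`edgeLabel u w` is the
label at `u` of the edge from `u` to `w`, relevant only for adjacent `u`, `w`), and the bits
stored at each node to represent its local routing function. -/
structure RoutingScheme {n : ℕ} (G : SimpleGraph (Fin n)) where
  label : Fin n → ℕ
  label_injective : Function.Injective label
  edgeLabel : Fin n → Fin n → ℕ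
  edgeLabel_injOn : ∀ u, Set.InjOn (edgeLabel u) (G.neighborSet u)
  bits : Fin n → List Bool

namespace RoutingScheme

variable {n : ℕ} {G : SimpleGraph (Fin n)}

/-- The edge labels conform to the model. -/
def EdgesConform (S : RoutingScheme G) : EdgeModel → Prop
  | .freePorts => ∀ u, Set.BijOn (S.edgeLabel u) (G.neighborSet u)
      (Set.Icc 1 (G.neighborSet u).ncard)
  | .neighboursKnown => ∀ u w, G.Adj u w → S.edgeLabel u w = S.label w

/-- The node labels conform to the model. -/
def LabelsConform (S : RoutingScheme G) : LabelModel → Prop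
  | .fixed => ∀ u, S.label u = (u : ℕ) + 1
  | .permuted => ∀ u, S.label u ∈ Set.Icc 1 n
  | .free => True

open Classical in
/-- The labels of the edges incident to `u`, in increasing order. -/
noncomputable def incidentLabels (S : RoutingScheme G) (u : Fin n) : List ℕ :=
  ((Finset.univ.filter fun w => G.Adj u w).image (S.edgeLabel u)).sort (· ≤ ·)

/-- The local routing function of `u` applied to the destination `v`. -/
noncomputable def route (S : RoutingScheme G) (D : Decoder) (u v : Fin n) : ℕ :=
  D (S.bits u, S.label u, S.incidentLabels u, S.label v)

/-- `S.Delivers D k u v`: a message at `u` with destination `v`, forwarded by the local routing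
functions, arrives at `v` after traversing exactly `k` edges. -/
inductive Delivers (S : RoutingScheme G) (D : Decoder) : ℕ → Fin n → Fin n → Prop
  | arrived (v : Fin n) : Delivers S D 0 v v
  | hop {k : ℕ} {u v w : Fin n} (hne : u ≠ v) (hadj : G.Adj u w)
      (hroute : S.route D u v = S.edgeLabel u w) (hrest : Delivers S D k w v) :
      Delivers S D (k + 1) u v

/-- Every pair of nodes is connected by a route, and every route is a shortest path.
(`Delivers` forces `u` and `v` to be connected, so `dist` has no junk value here.) -/
def IsShortestPath (S : RoutingScheme G) (D : Decoder) : Prop :=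
  ∀ u v, S.Delivers D (G.dist u v) u v

/-- The number of bits charged to the node `u`. -/
def nodeCost (S : RoutingScheme G) : LabelModel → Fin n → ℕ
  | .free, u => (S.bits u).length + Nat.size (S.label u)
  | _, u => (S.bits u).length

end RoutingScheme

end CompactRouting

namespace CompactRouting

/-!
In a random graph two nodes are at distance at most 2. So `u` can forward to a non-neighbour `v`
through the first neighbour of `u`, in the increasing order, that is adjacent to `v`. The position
of this relay among the neighbours of `u` is below `t` with probability `1 - 2⁻ᵗ`, hence about 2 on
average, and half of the nodes `v` are not neighbours. Writing these positions in unary, with a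
terminator for every `v`, therefore takes about `2 n` bits at `u`.

The graphs for which some node needs `11 n / 4` bits or more, or has a node at distance more than
2, make up an exponentially small fraction of all graphs: fix the set of neighbours of `u`; the
relay positions of different `v` then depend on disjoint sets of edges, so that the exponential
moment of their sum is a product. As these graphs can be enumerated, each of them is determined by
its index in the enumeration, which saves at least `n / 16 - 1` bits, and it is not random.

The same table serves all six models: the labels chosen are always `1, …, n`, with every edge
carrying either the rank or the label of its end point, and in both cases the increasing order of
the edge labels is that of the neighbours.
-/

open scoped BigOperators Finset

/-! ### Enumerations and complexity -/

section Primrec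

variable {α β : Type*} [Primcodable α] [Primcodable β]

theorem primrec_idxOf [BEq α] [LawfulBEq α] : Primrec₂ (List.idxOf : α → List α → ℕ) := by
  classical
  refine (Primrec.list_idxOf (α := α)).of_eq fun a l => ?_
  congr
  exact lawful_beq_subsingleton _ _

theorem primrec_filter {f : α → List β} {p : α → β → Bool} (hf : Primrec f) (hp : Primrec₂ p) :
    Primrec fun a => (f a).filter (p a) := by
  refine (Primrec.listFilterMap hf (g := fun a b => bif p a b then some b else none)
    (Primrec.cond hp (Primrec.option_some.comp Primrec.snd) (Primrec.const none))).of_eq fun a => ?_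
  rw [← List.filterMap_eq_filter]
  congr! 2 with b
  cases h : p a b <;> simp [Option.guard, h]

theorem primrecPred_forall_mem {f : α → List β} {p : α → β → Prop} (hf : Primrec f)
    (hp : PrimrecRel p) : PrimrecPred fun a => ∀ b ∈ f a, p a b :=
  (PrimrecRel.forall_mem_list (R := fun b a => p a b) (hp.comp Primrec.snd Primrec.fst)).comp hf
    Primrec.id

theorem primrecPred_exists_mem {f : α → List β} {p : α → β → Prop} (hf : Primrec f)
    (hp : PrimrecRel p) : PrimrecPred fun a => ∃ b ∈ f a, p a b :=
  (PrimrecRel.exists_mem_list (R := fun b a => p a b) (hp.comp Primrec.snd Primrec.fst)).comp hf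
    Primrec.id

end Primrec

/-- The list of all binary strings of a given length, in lexicographical order. -/
def bitStrings : ℕ → List (List Bool)
  | 0 => [[]]
  | k + 1 => (bitStrings k).map (List.cons false) ++ (bitStrings k).map (List.cons true)

theorem mem_bitStrings {k : ℕ} {s : List Bool} : s ∈ bitStrings k ↔ s.length = k := by
  induction k generalizing s with
  | zero => simp [bitStrings]
  | succ k ih => rcases s with _ | ⟨_ | _, s⟩ <;> simp [bitStrings, ih]

theorem length_bitStrings (k : ℕ) : (bitStrings k).length = 2 ^ k := by
  induction k with
  | zero => rfl
  | succ k ih => simp [bitStrings, ih, pow_succ, mul_two]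

theorem nodup_bitStrings (k : ℕ) : (bitStrings k).Nodup := by
  induction k with
  | zero => simp [bitStrings]
  | succ k ih =>
    refine (ih.map List.cons_injective).append (ih.map List.cons_injective) ?_
    simp [List.Disjoint]

theorem primrec_bitStrings : Primrec bitStrings := by
  have hmap (b : Bool) : Primrec fun p : ℕ × List (List Bool) => p.2.map (List.cons b) :=
    Primrec.list_map Primrec.snd (Primrec.list_cons.comp₂ (Primrec₂.const b) Primrec₂.right)
  refine (Primrec.nat_rec₁ [[]] (Primrec.list_append.comp (hmap false) (hmap true)).to₂).of_eq
    fun k => ?_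
  induction k with
  | zero => rfl
  | succ k ih => simp only [bitStrings, ← ih]

theorem complexity_le {U : Machine} {p x : List Bool} {y : ℕ} (h : x ∈ U (p, y)) :
    complexity U x y ≤ p.length :=
  Nat.sInf_le ⟨p, rfl, h⟩

theorem IsUniversal.exists_complexity_le {U : Machine} (hU : IsUniversal U)
    {f : ℕ → List (List Bool)} (hf : Computable f) :
    ∃ c, ∀ (y k : ℕ) (x : List Bool), x ∈ f y → (f y).length ≤ 2 ^ k →
      complexity U x y ≤ k + c := by
  -- A program of length `k` is read as an index into `f y`: its rank in `bitStrings k`.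
  let V : Machine := fun a => ((f a.2)[(bitStrings a.1.length).idxOf a.1]? : Part (List Bool))
  have hrank : Computable fun a : List Bool × ℕ => (bitStrings a.1.length).idxOf a.1 :=
    (primrec_idxOf.comp Primrec.fst
      (primrec_bitStrings.comp (Primrec.list_length.comp Primrec.fst))).to_comp
  have hV : Partrec V :=
    Computable.ofOption (Computable.list_getElem?.comp (hf.comp Computable.snd) hrank)
  obtain ⟨c, tr, htr⟩ := hU.2 V hV
  refine ⟨c, fun y k x hx hk => ?_⟩
  obtain ⟨i, hi, rfl⟩ := List.getElem_of_mem hx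
  have hik : i < (bitStrings k).length := by rw [length_bitStrings]; exact hi.trans_le hk
  have hlength : (bitStrings k)[i].length = k := mem_bitStrings.1 (List.getElem_mem hik)
  have hout : (f y)[i] ∈ U (tr (bitStrings k)[i], y) := by
    rw [(htr _).2]
    simp [V, hlength, (nodup_bitStrings k).idxOf_getElem i hik, hi]
  calc complexity U (f y)[i] y ≤ (tr (bitStrings k)[i]).length := complexity_le hout
    _ ≤ (bitStrings k)[i].length + c := (htr _).1
    _ = k + c := by rw [hlength]

/-! ### Hop tables -/

section HopTable

variable {V W : Type*} (A : V → V → Bool) (l : List V)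

/-- The neighbours of `u` in the graph with adjacency test `A`, in the order of the list `l` of
all nodes. -/
def neighbours (u : V) : List V := l.filter (A u)

/-- What a node `u` has to know to forward towards `v`: `0` if `v` is a neighbour, and otherwise
`i + 1` where `i` is the position, in the list of neighbours of `u`, of the first neighbour of
`v`. -/
def hopIndex (u v : V) : ℕ := bif A u v then 0 else (neighbours A l u).findIdx (A · v) + 1

/-- The hop indices at `u` of all destinations. -/
def hopTable (u : V) : List ℕ := l.map (hopIndex A l u)

/-- The self-delimiting code `1ᵗ0` of the number `t`. -/
def unary (t : ℕ) : List Bool := List.replicate t true ++ [false]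

/-- The bits stored at `u`: the hop table of `u` in unary. -/
def routingBits (u : V) : List Bool := (hopTable A l u).flatMap unary

/-- The properties of a graph that make its hop tables a shortest path routing scheme with at most
`11 n / 4` bits per node: the tables are short and the diameter is at most 2. -/
def IsTypical : Prop :=
  ∀ u ∈ l, 4 * (routingBits A l u).length < 11 * l.length ∧
    ∀ v ∈ l, u = v ∨ ∃ w ∈ l, A u w ∧ A w v

instance [DecidableEq V] : Decidable (IsTypical A l) := by
  unfold IsTypical; infer_instance

theorem length_routingBits (u : V) :
    (routingBits A l u).length = (l.map (hopIndex A l u)).sum + l.length := by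
  simp [routingBits, hopTable, unary, List.length_flatMap, Function.comp_def]

variable {A l}

theorem hopIndex_eq_zero {u v : V} : hopIndex A l u v = 0 ↔ A u v := by
  cases h : A u v <;> simp [hopIndex, h]

section Map

variable (A : W → W → Bool) (l : List V) (f : V → W)

theorem hopIndex_map (u v : V) :
    hopIndex A (l.map f) (f u) (f v) = hopIndex (fun a b => A (f a) (f b)) l u v := by
  simp [hopIndex, neighbours, List.filter_map, List.findIdx_map, Function.comp_def]

theorem routingBits_map (u : V) :
    routingBits A (l.map f) (f u) = routingBits (fun a b => A (f a) (f b)) l u := by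
  simp [routingBits, hopTable, Function.comp_def, hopIndex_map]

theorem isTypical_map {f : V → W} (hf : Function.Injective f) :
    IsTypical A (l.map f) ↔ IsTypical (fun a b => A (f a) (f b)) l := by
  simp [IsTypical, routingBits_map, hf.eq_iff]

end Map

end HopTable

section PrimrecHopTable

variable {α V : Type*} [Primcodable α] [Primcodable V] {A : α → V → V → Bool} {l : α → List V}

theorem primrec_hopIndex (hA : Primrec fun x : α × V × V => A x.1 x.2.1 x.2.2) (hl : Primrec l) :
    Primrec fun x : α × V × V => hopIndex (A x.1) (l x.1) x.2.1 x.2.2 := by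
  have hnbr : Primrec fun x : α × V × V => neighbours (A x.1) (l x.1) x.2.1 :=
    primrec_filter (hl.comp Primrec.fst) (hA.comp (Primrec.pair (Primrec.fst.comp Primrec.fst)
      (Primrec.pair (Primrec.fst.comp (Primrec.snd.comp Primrec.fst)) Primrec.snd)))
  refine Primrec.cond hA (Primrec.const 0) (Primrec.succ.comp (Primrec.list_findIdx hnbr ?_))
  exact hA.comp (Primrec.pair (Primrec.fst.comp Primrec.fst)
    (Primrec.pair Primrec.snd (Primrec.snd.comp (Primrec.snd.comp Primrec.fst))))

theorem primrec_unary : Primrec unary :=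
  (Primrec.list_append.comp (Primrec.list_map Primrec.list_range (Primrec₂.const true))
    (Primrec.const [false])).of_eq fun t => by simp [unary]

theorem primrec_routingBits (hA : Primrec fun x : α × V × V => A x.1 x.2.1 x.2.2)
    (hl : Primrec l) : Primrec₂ fun a u => routingBits (A a) (l a) u :=
  Primrec.list_flatMap (Primrec.list_map (hl.comp Primrec.fst)
    ((primrec_hopIndex hA hl).comp (Primrec.pair (Primrec.fst.comp Primrec.fst)
      (Primrec.pair (Primrec.snd.comp Primrec.fst) Primrec.snd))))
    (primrec_unary.comp Primrec.snd)

theorem primrecPred_isTypical (hA : Primrec fun x : α × V × V => A x.1 x.2.1 x.2.2)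
    (hl : Primrec l) : PrimrecPred fun a => IsTypical (A a) (l a) := by
  have hadj {γ : Type _} [Primcodable γ] {a : γ → α} {u v : γ → V} (ha : Primrec a)
      (hu : Primrec u) (hv : Primrec v) : PrimrecPred fun x => A (a x) (u x) (v x) = true :=
    Primrec.eq.comp (hA.comp (Primrec.pair ha (Primrec.pair hu hv))) (Primrec.const true)
  have hlong : PrimrecRel fun (a : α) u =>
      4 * (routingBits (A a) (l a) u).length < 11 * (l a).length :=
    Primrec.nat_lt.comp
      (Primrec.nat_mul.comp (Primrec.const 4) (Primrec.list_length.comp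
        (primrec_routingBits hA hl)))
      (Primrec.nat_mul.comp (Primrec.const 11) (Primrec.list_length.comp (hl.comp Primrec.fst)))
  have hnear : PrimrecRel fun (x : α × V) v => x.2 = v ∨ ∃ w ∈ l x.1, A x.1 x.2 w ∧ A x.1 w v := by
    have hfst : Primrec fun x : ((α × V) × V) × V => x.1.1.1 :=
      Primrec.fst.comp (Primrec.fst.comp Primrec.fst)
    exact (Primrec.eq.comp (Primrec.snd.comp Primrec.fst) Primrec.snd).or
      (primrecPred_exists_mem (hl.comp (Primrec.fst.comp Primrec.fst))
        ((hadj hfst (Primrec.snd.comp (Primrec.fst.comp Primrec.fst)) Primrec.snd).and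
          (hadj hfst Primrec.snd (Primrec.snd.comp Primrec.fst))))
  exact primrecPred_forall_mem hl
    (hlong.and (primrecPred_forall_mem (hl.comp Primrec.fst) hnear))

end PrimrecHopTable

/-! ### The decoder -/

/-- Inverse of the concatenation of unary codes. -/
def unaryDecode (s : List Bool) : List ℕ :=
  s.foldr (fun b t => bif b then (t.headI + 1) :: t.tail else 0 :: t) []

theorem unaryDecode_flatMap_unary (t : List ℕ) : unaryDecode (t.flatMap unary) = t := by
  have hcons (k : ℕ) (s : List Bool) : unaryDecode (unary k ++ s) = k :: unaryDecode s := by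
    simp only [unaryDecode, unary, List.foldr_append]
    induction k with
    | zero => rfl
    | succ k ih => rw [List.replicate_succ, List.foldr_cons, ih]; rfl
  induction t with
  | nil => rfl
  | cons k t ih => rw [List.flatMap_cons, hcons, ih]

/-- The position, among the edges at a node with hop table `t`, of the edge towards the node
number `i`: an entry `0` announces a neighbour, which comes after the neighbours announced by the
previous entries `0`. -/
def edgePosition (t : List ℕ) (i : ℕ) : ℕ :=
  if t.getD i 0 = 0 then (t.take i).count 0 else t.getD i 0 - 1

/-- The decoder for hop tables, which serves all models.  Nodes are labeled from `1`. -/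
def hopDecoder : Decoder := fun x =>
  x.2.2.1.getD (edgePosition (unaryDecode x.1) (x.2.2.2 - 1)) 0

theorem primrec_unaryDecode : Primrec unaryDecode := by
  have htail : Primrec fun a : List Bool × Bool × List ℕ => a.2.2 := Primrec.snd.comp Primrec.snd
  have hstep : Primrec₂ fun (_ : List Bool) (p : Bool × List ℕ) =>
      bif p.1 then (p.2.headI + 1) :: p.2.tail else 0 :: p.2 :=
    Primrec.cond (Primrec.fst.comp Primrec.snd)
      (Primrec.list_cons.comp (Primrec.succ.comp (Primrec.list_headI.comp htail))
        (Primrec.list_tail.comp htail))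
      (Primrec.list_cons.comp (Primrec.const 0) htail)
  exact Primrec.list_foldr Primrec.id (Primrec.const []) hstep

theorem primrec_edgePosition : Primrec₂ edgePosition := by
  have hentry : Primrec fun p : List ℕ × ℕ => p.1.getD p.2 0 := Primrec.list_getD 0
  have hcount : Primrec fun t : List ℕ => t.count 0 :=
    (Primrec.list_length.comp (Primrec.listFilter (Primrec.eq.comp Primrec.id
      (Primrec.const 0)))).of_eq fun t => by simp [List.count, List.countP_eq_length_filter]; rfl
  exact Primrec.ite (Primrec.eq.comp hentry (Primrec.const 0))
    (hcount.comp (Primrec.list_take.comp Primrec.snd Primrec.fst)) (Primrec.pred.comp hentry)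

theorem computable_hopDecoder : Computable hopDecoder := by
  have hlabels : Primrec fun x : List Bool × ℕ × List ℕ × ℕ => x.2.2 :=
    Primrec.snd.comp Primrec.snd
  exact ((Primrec.list_getD 0).comp (Primrec.fst.comp hlabels)
    (primrec_edgePosition.comp (primrec_unaryDecode.comp Primrec.fst)
      (Primrec.pred.comp (Primrec.snd.comp hlabels)))).to_comp

theorem getElem?_filter_countP_take {V : Type*} (p : V → Bool) {l : List V} {i : ℕ}
    (hi : i < l.length) (hp : p l[i]) : (l.filter p)[(l.take i).countP p]? = some l[i] := by
  have hsplit : l.filter p = (l.take i).filter p ++ l[i] :: (l.drop (i + 1)).filter p := by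
    rw [← List.filter_cons_of_pos hp, ← List.filter_append, List.getElem_cons_drop,
      List.take_append_drop]
  rw [hsplit, List.countP_eq_length_filter, List.getElem?_append_right le_rfl]
  simp

section EdgePosition

variable {V : Type*} {A : V → V → Bool} {l : List V} {u : V} {i : ℕ}

theorem getD_hopTable (hi : i < l.length) : (hopTable A l u).getD i 0 = hopIndex A l u l[i] := by
  simp [hopTable, hi]

theorem getElem?_edgePosition_of_adj (hi : i < l.length) (hadj : A u l[i]) :
    (neighbours A l u)[edgePosition (hopTable A l u) i]? = some l[i] := by
  have hcount : ((hopTable A l u).take i).count 0 = (l.take i).countP (A u) := by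
    rw [hopTable, ← List.map_take, List.count, List.countP_map]
    refine List.countP_congr fun v _ => ?_
    simp [hopIndex_eq_zero]
  rw [edgePosition, getD_hopTable hi, if_pos (hopIndex_eq_zero.2 hadj), hcount]
  exact getElem?_filter_countP_take _ hi hadj

theorem exists_getElem?_edgePosition_of_not_adj (hi : i < l.length) (hadj : ¬ A u l[i])
    (hnear : ∃ w ∈ l, A u w ∧ A w l[i]) :
    ∃ w, A u w ∧ A w l[i] ∧ (neighbours A l u)[edgePosition (hopTable A l u) i]? = some w := by
  have hpos : edgePosition (hopTable A l u) i = (neighbours A l u).findIdx (A · l[i]) := by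
    rw [edgePosition, getD_hopTable hi, if_neg (hadj ∘ hopIndex_eq_zero.1), hopIndex,
      Bool.eq_false_iff.2 hadj]
    rfl
  have hlt : (neighbours A l u).findIdx (A · l[i]) < (neighbours A l u).length := by
    obtain ⟨w, hw, huw, hwv⟩ := hnear
    exact List.findIdx_lt_length.2 ⟨w, List.mem_filter.2 ⟨hw, huw⟩, hwv⟩
  refine ⟨_, (List.mem_filter.1 (List.getElem_mem hlt)).2, List.findIdx_getElem (w := hlt), ?_⟩
  rw [hpos, List.getElem?_eq_getElem hlt]

end EdgePosition

/-! ### The routing scheme of a typical graph -/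

open Classical in
/-- The bit telling whether `u` and `v` are adjacent. -/
noncomputable def adjBit {V : Type*} (G : SimpleGraph V) (u v : V) : Bool := decide (G.Adj u v)

@[simp]
theorem adjBit_eq_true {V : Type*} {G : SimpleGraph V} {u v : V} :
    adjBit G u v = true ↔ G.Adj u v := by
  simp [adjBit]

theorem adjBit_comm {V : Type*} (G : SimpleGraph V) (u v : V) : adjBit G u v = adjBit G v u :=
  decide_eq_decide.2 (G.adj_comm u v)

section Scheme

variable {n : ℕ} (G : SimpleGraph (Fin n))

/-- The neighbours of `u` in increasing order. -/
noncomputable def neighbourList (u : Fin n) : List (Fin n) :=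
  neighbours (adjBit G) (List.finRange n) u

variable {G} in
theorem mem_neighbourList {u w : Fin n} : w ∈ neighbourList G u ↔ G.Adj u w := by
  simp [neighbourList, neighbours]

theorem pairwise_neighbourList (u : Fin n) : (neighbourList G u).Pairwise (· < ·) :=
  (List.pairwise_lt_finRange n).filter _

theorem nodup_neighbourList (u : Fin n) : (neighbourList G u).Nodup :=
  (List.nodup_finRange n).filter _

/-- The label at `u` of the edge to `w`.  Ports are assigned in the order of the neighbours, so in
both models the increasing list of the edge labels lists the neighbours in increasing order. -/
noncomputable def edgeName (u w : Fin n) : EdgeModel → ℕ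
  | .freePorts => (neighbourList G u).idxOf w + 1
  | .neighboursKnown => w + 1

theorem injOn_edgeName (E : EdgeModel) (u : Fin n) :
    Set.InjOn (edgeName G u · E) (G.neighborSet u) := by
  intro v hv w _ h
  cases E with
  | freePorts => exact (List.idxOf_inj (mem_neighbourList.2 hv)).1 (Nat.succ_injective h)
  | neighboursKnown => exact Fin.ext (Nat.succ_injective h)

theorem pairwise_map_edgeName (E : EdgeModel) (u : Fin n) :
    ((neighbourList G u).map (edgeName G u · E)).Pairwise (· < ·) := by
  rw [List.pairwise_map]
  cases E with
  | freePorts =>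
    refine List.pairwise_iff_getElem.2 fun i j hi hj hij => ?_
    simpa [edgeName, (nodup_neighbourList G u).idxOf_getElem] using hij
  | neighboursKnown => exact (pairwise_neighbourList G u).imp Nat.succ_lt_succ

/-- The routing scheme in which every node stores its hop table and nodes are not relabeled. -/
noncomputable def hopScheme (E : EdgeModel) : RoutingScheme G where
  label u := u + 1
  label_injective _ _ h := Fin.ext (Nat.succ_injective h)
  edgeLabel u w := edgeName G u w E
  edgeLabel_injOn := injOn_edgeName G E
  bits := routingBits (adjBit G) (List.finRange n)

theorem hopScheme_labelsConform (E : EdgeModel) (L : LabelModel) :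
    (hopScheme G E).LabelsConform L := by
  cases L with
  | fixed => exact fun u => rfl
  | permuted => exact fun u => ⟨Nat.succ_pos _, u.2⟩
  | free => trivial

theorem ncard_neighborSet (u : Fin n) : (G.neighborSet u).ncard = (neighbourList G u).length := by
  have hset : G.neighborSet u = ((neighbourList G u).toFinset : Set (Fin n)) := by
    ext w
    simp [mem_neighbourList]
  rw [hset, Set.ncard_coe_finset, List.toFinset_card_of_nodup (nodup_neighbourList G u)]

theorem hopScheme_edgesConform (E : EdgeModel) : (hopScheme G E).EdgesConform E := by
  cases E with
  | neighboursKnown => exact fun u w _ => rfl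
  | freePorts =>
    intro u
    rw [ncard_neighborSet]
    refine ⟨fun w hw => ⟨Nat.succ_pos _, List.idxOf_lt_length_iff.2 (mem_neighbourList.2 hw)⟩,
      injOn_edgeName G .freePorts u, fun i hi => ?_⟩
    obtain ⟨j, rfl⟩ := Nat.exists_eq_add_of_le' hi.1
    have hj : j < (neighbourList G u).length := hi.2
    exact ⟨_, mem_neighbourList.1 (List.getElem_mem hj),
      congrArg (· + 1) ((nodup_neighbourList G u).idxOf_getElem j hj)⟩

theorem incidentLabels_hopScheme (E : EdgeModel) (u : Fin n) :
    (hopScheme G E).incidentLabels u = (neighbourList G u).map (edgeName G u · E) := by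
  classical
  have hpw := pairwise_map_edgeName G E u
  rw [← (List.toFinset_sort (· ≤ ·) (hpw.imp ne_of_lt)).2 (hpw.imp le_of_lt),
    RoutingScheme.incidentLabels]
  refine congrArg (Finset.sort · _) (Finset.ext fun x => ?_)
  simp [hopScheme, mem_neighbourList]

theorem route_hopScheme (E : EdgeModel) {u v w : Fin n}
    (h : (neighbourList G u)[edgePosition (hopTable (adjBit G) (List.finRange n) u) v]? = some w) :
    (hopScheme G E).route hopDecoder u v = (hopScheme G E).edgeLabel u w := by
  rw [RoutingScheme.route, hopDecoder, incidentLabels_hopScheme]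
  simp [hopScheme, routingBits, unaryDecode_flatMap_unary, h]

theorem dist_eq_two {V : Type*} {G : SimpleGraph V} {u v w : V} (huv : u ≠ v) (hadj : ¬ G.Adj u v)
    (huw : G.Adj u w) (hwv : G.Adj w v) : G.dist u v = 2 := by
  have hle : G.dist u v ≤ 2 := SimpleGraph.dist_le (.cons huw (.cons hwv .nil))
  have hzero : G.dist u v ≠ 0 := fun h =>
    huv ((huw.reachable.trans hwv.reachable).dist_eq_zero_iff.1 h)
  have hone : G.dist u v ≠ 1 := fun h => hadj (SimpleGraph.dist_eq_one_iff_adj.1 h)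
  omega

theorem hopScheme_isShortestPath (E : EdgeModel)
    (hG : ∀ u v, u = v ∨ ∃ w, G.Adj u w ∧ G.Adj w v) :
    (hopScheme G E).IsShortestPath hopDecoder := by
  have hone {u v : Fin n} (h : G.Adj u v) : (hopScheme G E).Delivers hopDecoder 1 u v := by
    have hpos := getElem?_edgePosition_of_adj (A := adjBit G) (l := List.finRange n) (u := u)
      (i := v) (by simp) (by simpa using h)
    exact .hop h.ne h (route_hopScheme G E (by simpa [neighbourList] using hpos)) (.arrived v)
  intro u v
  by_cases huv : u = v
  · rw [huv, SimpleGraph.dist_self]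
    exact .arrived v
  by_cases hadj : G.Adj u v
  · rw [SimpleGraph.dist_eq_one_iff_adj.2 hadj]
    exact hone hadj
  obtain ⟨x, hux, hxv⟩ := (hG u v).resolve_left huv
  obtain ⟨w, huw, hwv, hpos⟩ := exists_getElem?_edgePosition_of_not_adj (A := adjBit G)
    (l := List.finRange n) (u := u) (i := v) (by simp) (by simpa using hadj)
    ⟨x, List.mem_finRange x, by simpa using ⟨hux, hxv⟩⟩
  have huw' : G.Adj u w := adjBit_eq_true.1 huw
  have hwv' : G.Adj w v := by simpa using hwv
  rw [dist_eq_two huv hadj huw' hwv']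
  exact .hop huv huw' (route_hopScheme G E hpos) (hone hwv')

theorem nodeCost_hopScheme_le (E : EdgeModel) (L : LabelModel) {u : Fin n}
    (hsize : 4 * n.size ≤ n)
    (hbits : 4 * (routingBits (adjBit G) (List.finRange n) u).length < 11 * n) :
    (hopScheme G E).nodeCost L u ≤ 3 * n := by
  have hlength : 4 * ((hopScheme G E).bits u).length < 11 * n := hbits
  have hlabel : Nat.size ((hopScheme G E).label u) ≤ n.size := Nat.size_le_size u.2
  cases L <;> simp only [RoutingScheme.nodeCost] <;> omega

theorem exists_scheme_of_isTypical (E : EdgeModel) (L : LabelModel) (hsize : 4 * n.size ≤ n)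
    (hG : IsTypical (adjBit G) (List.finRange n)) :
    ∃ S : RoutingScheme G, S.EdgesConform E ∧ S.LabelsConform L ∧ S.IsShortestPath hopDecoder ∧
      (∀ u, S.nodeCost L u ≤ 3 * n) ∧ ∑ u, S.nodeCost L u ≤ 3 * n ^ 2 := by
  simp only [IsTypical, List.mem_finRange, List.length_finRange, adjBit_eq_true, true_and,
    forall_const] at hG
  have hcost (u : Fin n) : (hopScheme G E).nodeCost L u ≤ 3 * n :=
    nodeCost_hopScheme_le G E L hsize (hG u).1
  refine ⟨hopScheme G E, hopScheme_edgesConform G E, hopScheme_labelsConform G E L,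
    hopScheme_isShortestPath G E fun u => (hG u).2, hcost, ?_⟩
  calc ∑ u, (hopScheme G E).nodeCost L u ≤ ∑ _u : Fin n, 3 * n :=
        Finset.sum_le_sum fun u _ => hcost u
    _ = 3 * n ^ 2 := by simp; ring

end Scheme

/-! ### Graph codes -/

/-- The pairs `u < v < n` in lexicographical order. -/
def nodePairs (n : ℕ) : List (ℕ × ℕ) :=
  (List.range n ×ˢ List.range n).filter fun e => e.1 < e.2

/-- The adjacency test of the graph on `0, …, n - 1` with code `c`. -/
def codeAdj (n : ℕ) (c : List Bool) (a b : ℕ) : Bool :=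
  a != b && c.getD ((nodePairs n).idxOf (min a b, max a b)) false

/-- The graph with code `c`. -/
def codeGraph (n : ℕ) (c : List Bool) : SimpleGraph (Fin n) where
  Adj a b := codeAdj n c a b
  symm := ⟨fun a b h => by rwa [codeAdj, bne_comm, min_comm, max_comm, ← codeAdj]⟩
  loopless := ⟨fun a => by simp [codeAdj]⟩

theorem mem_nodePairs {n : ℕ} {e : ℕ × ℕ} : e ∈ nodePairs n ↔ e.1 < e.2 ∧ e.2 < n := by
  rw [nodePairs, List.mem_filter, List.mem_product]
  simp only [List.mem_range, decide_eq_true_eq]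
  omega

theorem nodup_nodePairs (n : ℕ) : (nodePairs n).Nodup :=
  (List.nodup_range.product List.nodup_range).filter _

theorem length_nodePairs (n : ℕ) : (nodePairs n).length = n.choose 2 := by
  have hset : (nodePairs n).toFinset = {e ∈ Finset.range n ×ˢ Finset.range n | e.1 < e.2} := by
    ext e
    simp only [List.mem_toFinset, mem_nodePairs, Finset.mem_filter, Finset.mem_product,
      Finset.mem_range]
    omega
  have hfiber (b : ℕ) (hb : b ∈ Finset.range n) : #{a ∈ Finset.range n | a < b} = b := by
    have hlt : ∀ a, a < b → a < n := fun a ha => ha.trans (Finset.mem_range.1 hb)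
    rw [← Finset.card_range b]
    congr 1
    ext a
    simpa using hlt a
  rw [← List.toFinset_card_of_nodup (nodup_nodePairs n), hset, Finset.card_filter,
    Finset.sum_product_right, Nat.choose_two_right, ← Finset.sum_range_id]
  exact Finset.sum_congr rfl fun b hb => by rw [← Finset.card_filter, hfiber b hb]

theorem nodePairs_eq_map (n : ℕ) : nodePairs n =
    ((List.finRange n ×ˢ List.finRange n).filter fun e => e.1 < e.2).map
      (Prod.map Fin.val Fin.val) := by
  have hprod : List.range n ×ˢ List.range n =
      (List.finRange n ×ˢ List.finRange n).map (Prod.map Fin.val Fin.val) := by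
    rw [← List.map_coe_finRange_eq_range]
    simp only [SProd.sprod, List.product, List.map_flatMap, List.flatMap_map, List.map_map]
    rfl
  rw [nodePairs, hprod, List.filter_map]
  rfl

theorem getD_map_idxOf {α β : Type*} [BEq α] [LawfulBEq α] {l : List α} {a : α} (ha : a ∈ l)
    (f : α → β) (d : β) : (l.map f).getD (l.idxOf a) d = f a := by
  have hlt := List.idxOf_lt_length_iff.2 ha
  simp [hlt]

theorem map_getD_idxOf {α β : Type*} [BEq α] [LawfulBEq α] {l : List α} (hl : l.Nodup) {c : List β}
    (hc : c.length = l.length) (d : β) : l.map (fun a => c.getD (l.idxOf a) d) = c := by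
  refine List.ext_getElem (by simp [hc]) fun i _ hi => ?_
  simp [hl.idxOf_getElem, hi]

section GraphCode

variable {n : ℕ}

theorem graphCode_eq_map_adjBit (G : SimpleGraph (Fin n)) : graphCode G =
    ((List.finRange n ×ˢ List.finRange n).filter fun e => e.1 < e.2).map
      fun e => adjBit G e.1 e.2 := rfl

theorem length_graphCode (G : SimpleGraph (Fin n)) : (graphCode G).length = n.choose 2 := by
  rw [← length_nodePairs, nodePairs_eq_map, graphCode_eq_map_adjBit, List.length_map,
    List.length_map]

theorem codeAdj_graphCode (G : SimpleGraph (Fin n)) (a b : Fin n) :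
    codeAdj n (graphCode G) a b = adjBit G a b := by
  wlog hab : a < b generalizing a b
  · rcases (not_lt.1 hab).eq_or_lt with rfl | hba
    · simp [codeAdj, adjBit]
    · rw [adjBit_comm, ← this b a hba]
      simp only [codeAdj, bne_comm, min_comm, max_comm]
  have hval (x y : Fin n) : adjBit (G.map Fin.valEmbedding) x y = adjBit G x y :=
    decide_eq_decide.2 (SimpleGraph.map_adj_apply (f := Fin.valEmbedding))
  have hcode : graphCode G =
      (nodePairs n).map fun e => adjBit (G.map Fin.valEmbedding) e.1 e.2 := by
    rw [nodePairs_eq_map, List.map_map]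
    exact List.map_congr_left fun e _ => (hval e.1 e.2).symm
  have hne : (a : ℕ) ≠ b := Fin.val_ne_of_ne hab.ne
  rw [codeAdj, min_eq_left (Fin.le_def.1 hab.le), max_eq_right (Fin.le_def.1 hab.le), hcode,
    getD_map_idxOf (mem_nodePairs.2 ⟨hab, b.2⟩), bne_iff_ne.2 hne, Bool.true_and, hval]

theorem codeGraph_graphCode (G : SimpleGraph (Fin n)) : codeGraph n (graphCode G) = G := by
  ext a b
  simp only [codeGraph, codeAdj_graphCode, adjBit_eq_true]

theorem graphCode_injective : Function.Injective (graphCode (n := n)) :=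
  Function.LeftInverse.injective codeGraph_graphCode

theorem adjBit_codeGraph (c : List Bool) (a b : Fin n) :
    adjBit (codeGraph n c) a b = codeAdj n c a b :=
  Bool.eq_iff_iff.2 adjBit_eq_true

theorem graphCode_codeGraph {c : List Bool} (hc : c.length = n.choose 2) :
    graphCode (codeGraph n c) = c := by
  have hadj : graphCode (codeGraph n c) = (nodePairs n).map fun e => codeAdj n c e.1 e.2 := by
    rw [nodePairs_eq_map, List.map_map]
    exact List.map_congr_left fun e _ => adjBit_codeGraph c e.1 e.2
  rw [hadj]
  refine Eq.trans (List.map_congr_left fun e he => ?_)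
    (map_getD_idxOf (nodup_nodePairs n) (hc.trans (length_nodePairs n).symm) false)
  have hlt := (mem_nodePairs.1 he).1
  simp [codeAdj, hlt.ne, hlt.le]

theorem length_filter_bitStrings (P : List Bool → Prop) [DecidablePred P]
    [DecidablePred fun G : SimpleGraph (Fin n) => P (graphCode G)] :
    ((bitStrings (n.choose 2)).filter P).length =
      #{G : SimpleGraph (Fin n) | P (graphCode G)} := by
  rw [← List.toFinset_card_of_nodup ((nodup_bitStrings _).filter _),
    ← Finset.card_image_of_injective _ graphCode_injective]
  congr 1
  ext c
  simp only [List.mem_toFinset, List.mem_filter, mem_bitStrings, decide_eq_true_eq,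
    Finset.mem_image, Finset.mem_filter, Finset.mem_univ, true_and]
  constructor
  · exact fun ⟨hc, hP⟩ => ⟨codeGraph n c, by rwa [graphCode_codeGraph hc], graphCode_codeGraph hc⟩
  · rintro ⟨G, hP, rfl⟩
    exact ⟨length_graphCode G, hP⟩

theorem card_simpleGraph_fin : Fintype.card (SimpleGraph (Fin n)) = 2 ^ n.choose 2 := by
  have h := length_filter_bitStrings (n := n) fun _ => True
  simpa [length_bitStrings] using h.symm

theorem isTypical_codeAdj_graphCode (G : SimpleGraph (Fin n)) :
    IsTypical (codeAdj n (graphCode G)) (List.range n) ↔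
      IsTypical (adjBit G) (List.finRange n) := by
  have hmap := isTypical_map (codeAdj n (graphCode G)) (List.finRange n) Fin.val_injective
  simpa only [List.map_coe_finRange_eq_range, codeAdj_graphCode] using hmap

end GraphCode

/-- The codes of the graphs on `n` nodes that are not typical. -/
def atypicalCodes (n : ℕ) : List (List Bool) :=
  (bitStrings (n.choose 2)).filter fun c => ¬ IsTypical (codeAdj n c) (List.range n)

theorem primrec_nodePairs : Primrec nodePairs := by
  have hprod : Primrec fun n => List.range n ×ˢ List.range n :=
    Primrec.list_flatMap Primrec.list_range (Primrec.list_map (Primrec.list_range.comp Primrec.fst)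
      (Primrec.pair (Primrec.snd.comp Primrec.fst) Primrec.snd))
  exact (Primrec.listFilter Primrec.nat_lt).comp hprod

theorem primrec_codeAdj :
    Primrec fun x : (ℕ × List Bool) × ℕ × ℕ => codeAdj x.1.1 x.1.2 x.2.1 x.2.2 := by
  have hn : Primrec fun x : (ℕ × List Bool) × ℕ × ℕ => x.1.1 := Primrec.fst.comp Primrec.fst
  have hc : Primrec fun x : (ℕ × List Bool) × ℕ × ℕ => x.1.2 := Primrec.snd.comp Primrec.fst
  have ha : Primrec fun x : (ℕ × List Bool) × ℕ × ℕ => x.2.1 := Primrec.fst.comp Primrec.snd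
  have hb : Primrec fun x : (ℕ × List Bool) × ℕ × ℕ => x.2.2 := Primrec.snd.comp Primrec.snd
  exact Primrec.and.comp (Primrec.not.comp (Primrec.beq.comp ha hb))
    ((Primrec.list_getD false).comp hc (primrec_idxOf.comp
      (Primrec.pair (Primrec.nat_min.comp ha hb) (Primrec.nat_max.comp ha hb))
      (primrec_nodePairs.comp hn)))

theorem primrec_atypicalCodes : Primrec atypicalCodes := by
  have hbits : Primrec fun n : ℕ => bitStrings (n.choose 2) :=
    primrec_bitStrings.comp ((Primrec.list_length.comp primrec_nodePairs).of_eq length_nodePairs)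
  obtain ⟨_, htypical⟩ := primrecPred_isTypical
    (A := fun x : ℕ × List Bool => codeAdj x.1 x.2) primrec_codeAdj
    (Primrec.list_range.comp Primrec.fst)
  have hatypical : Primrec₂ fun n c => !decide (IsTypical (codeAdj n c) (List.range n)) :=
    (Primrec.not.comp htypical).of_eq fun _ => by simp
  exact (primrec_filter hbits hatypical).of_eq fun n => by simp [atypicalCodes]


/-! ### Averages over all graphs -/

section Independence

variable {α β K ι : Type*} [BooleanAlgebra α]

/-- `f x` is determined by the part of `x` below `s`. For graphs this says that `f` looks only at
the edges of `s`, so that functions with disjoint supports `s` are independent. -/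
def DependsBelow (f : α → β) (s : α) : Prop := ∀ x, f (x ⊓ s) = f x

theorem DependsBelow.mono {f : α → β} {s t : α} (hf : DependsBelow f s) (hst : s ≤ t) :
    DependsBelow f t := fun x => by
  rw [← hf, inf_assoc, inf_eq_right.2 hst, hf]

theorem DependsBelow.congr {f : α → β} {s x y : α} (hf : DependsBelow f s) (h : x ⊓ s = y ⊓ s) :
    f x = f y := by
  rw [← hf x, h, hf]

theorem DependsBelow.prod [CommMonoid β] {I : Finset ι} {f : ι → α → β} {s : α}
    (hf : ∀ i ∈ I, DependsBelow (f i) s) : DependsBelow (fun x => ∏ i ∈ I, f i x) s :=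
  fun x => Finset.prod_congr rfl fun i hi => hf i hi x

variable [Fintype α] [Semifield K] [CharZero K]

theorem expect_mul_of_disjoint {f g : α → K} {s t : α} (hf : DependsBelow f s)
    (hg : DependsBelow g t) (hst : Disjoint s t) :
    𝔼 x, f x * g x = (𝔼 x, f x) * 𝔼 x, g x := by
  -- Exchanging the parts of `x` and `y` outside `s` turns `f x * g x` into `f x * g y`.
  let mix (x y : α) : α := x ⊓ s ⊔ y \ s
  have mix_inf (x y : α) : mix x y ⊓ s = x ⊓ s := by
    simp [mix, inf_sup_right]
  have mix_sdiff (x y : α) : mix x y \ s = y \ s := by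
    simp [mix, sup_sdiff]
  have mix_mix (x y : α) : mix (mix x y) (mix y x) = x := by
    change mix x y ⊓ s ⊔ mix y x \ s = x
    rw [mix_inf, mix_sdiff, sup_inf_sdiff]
  have hmixf (x y : α) : f (mix x y) = f x := hf.congr (mix_inf x y)
  have hmixg (x y : α) : g (mix x y) = g y := by
    refine hg.congr ?_
    rw [inf_sup_right, inf_assoc, hst.eq_bot, inf_bot_eq, bot_sup_eq, sdiff_inf_right_comm,
      inf_sdiff_assoc, hst.symm.sdiff_eq_left]
  let swap : α × α ≃ α × α := Function.Involutive.toPerm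
    (fun p => (mix p.1 p.2, mix p.2 p.1)) fun p => Prod.ext (mix_mix _ _) (mix_mix _ _)
  calc 𝔼 x, f x * g x = 𝔼 p : α × α, f p.1 * g p.1 := by
        rw [← Finset.univ_product_univ, Finset.expect_product]
        simp
    _ = 𝔼 p : α × α, f p.1 * g p.2 :=
        Fintype.expect_equiv swap _ _ fun p => by
          change f p.1 * g p.1 = f (mix p.1 p.2) * g (mix p.2 p.1)
          rw [hmixf, hmixg]
    _ = (𝔼 x, f x) * 𝔼 x, g x := by
        rw [Fintype.expect_mul_expect, ← Finset.univ_product_univ, Finset.expect_product]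

theorem expect_prod_of_pairwiseDisjoint {I : Finset ι} {f : ι → α → K} {s : ι → α}
    (hf : ∀ i ∈ I, DependsBelow (f i) (s i)) (hs : (I : Set ι).PairwiseDisjoint s) :
    𝔼 x, ∏ i ∈ I, f i x = ∏ i ∈ I, 𝔼 x, f i x := by
  classical
  induction I using Finset.induction_on with
  | empty => simp
  | insert a I ha ih =>
    rw [Finset.forall_mem_insert] at hf
    rw [Finset.coe_insert, Set.pairwiseDisjoint_insert_of_notMem (by simpa using ha)] at hs
    have hrest : DependsBelow (fun x => ∏ i ∈ I, f i x) (I.sup s) :=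
      DependsBelow.prod fun i hi => (hf.2 i hi).mono (Finset.le_sup hi)
    simp only [Finset.prod_insert ha]
    rw [expect_mul_of_disjoint hf.1 hrest (Finset.disjoint_sup_right.2 fun i hi => hs.2 i hi),
      ih hf.2 hs.1]

end Independence

section RandomGraph

variable {V : Type*}

/-- The graph of all edges between `v` and the nodes in `S`. -/
def spokes (v : V) (S : Set V) : SimpleGraph V := (⊤ : SimpleGraph V).between {v} S

theorem adjBit_inf_spokes {v a : V} {S : Set V} (ha : a ∈ S) (G : SimpleGraph V) :
    adjBit (G ⊓ spokes v S) a v = adjBit G a v := by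
  refine Bool.eq_iff_iff.2 ?_
  have hne : G.Adj a v → a ≠ v := SimpleGraph.Adj.ne
  simp only [adjBit_eq_true, spokes, SimpleGraph.inf_adj, SimpleGraph.between_adj,
    SimpleGraph.top_adj, Set.mem_singleton_iff]
  tauto

theorem disjoint_spokes {u v : V} {S T : Set V} (huv : u ≠ v) (h : u ∈ T → v ∉ S) :
    Disjoint (spokes u S) (spokes v T) := by
  rw [SimpleGraph.disjoint_left]
  simp only [spokes, SimpleGraph.between_adj, Set.mem_singleton_iff]
  grind

theorem disjoint_spokes_self {v : V} {S T : Set V} (h : Disjoint S T) :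
    Disjoint (spokes v S) (spokes v T) := by
  have hST := Set.disjoint_left.1 h
  rw [SimpleGraph.disjoint_left]
  simp only [spokes, SimpleGraph.between_adj, Set.mem_singleton_iff, SimpleGraph.top_adj]
  grind

theorem dependsBelow_adjBit {β : Type*} {v a : V} {S : Set V} (ha : a ∈ S) (φ : Bool → β) :
    DependsBelow (fun G => φ (adjBit G a v)) (spokes v S) := fun G =>
  congrArg φ (adjBit_inf_spokes ha G)

theorem dependsBelow_findIdx {β : Type*} {v : V} {l : List V} {S : Set V} (hl : ∀ a ∈ l, a ∈ S)
    (φ : ℕ → β) : DependsBelow (fun G => φ (l.findIdx (adjBit G · v))) (spokes v S) := fun G => by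
  have hmap (p : V → Bool) : l.findIdx p = (l.map p).findIdx id := by
    rw [List.findIdx_map, Function.id_comp]
  simp only [hmap, List.map_congr_left fun a ha => adjBit_inf_spokes (hl a ha) G]

theorem hopIndex_self (G : SimpleGraph V) (l : List V) (u : V) : hopIndex (adjBit G) l u u = 1 := by
  have hself : adjBit G u u = false := by simp [adjBit]
  have hfirst : (neighbours (adjBit G) l u).findIdx (adjBit G · u) = 0 := by
    cases h : neighbours (adjBit G) l u with
    | nil => rfl
    | cons a t =>
      have ha : adjBit G u a = true :=
        List.of_mem_filter (show a ∈ neighbours (adjBit G) l u by simp [h])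
      simp [List.findIdx_cons, adjBit_comm G a, ha]
  simp [hopIndex, hself, hfirst]

variable [DecidableEq V]

/-- The factor that the destination `v` contributes to `x ^ ∑ v, hopIndex A l u v` when `R` is the
set of neighbours of `u`, and `0` if `R` is wrong about `v`. With `R` fixed, the factors of
different `v` look at disjoint sets of edges. -/
noncomputable def hopFactor (x : ℝ) (l : List V) (u : V) (R : Finset V) (v : V)
    (G : SimpleGraph V) : ℝ :=
  if v ∈ R then bif adjBit G u v then 1 else 0
  else (bif adjBit G u v then 0 else 1) * x ^ ((l.filter (· ∈ R)).findIdx (adjBit G · v) + 1)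

/-- The edges that `hopFactor` looks at. -/
def hopSupport (u : V) (R : Finset V) (v : V) : SimpleGraph V :=
  spokes v (if v ∈ R then {u} else insert u R)

theorem hopFactor_nonneg {x : ℝ} (hx : 0 ≤ x) (l : List V) (u : V) (R : Finset V) (v : V)
    (G : SimpleGraph V) : 0 ≤ hopFactor x l u R v G := by
  unfold hopFactor
  cases adjBit G u v <;> simp only [cond_true, cond_false] <;> positivity

theorem dependsBelow_hopFactor (x : ℝ) (l : List V) (u : V) (R : Finset V) (v : V) :
    DependsBelow (hopFactor x l u R v) (hopSupport u R v) := by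
  intro G
  unfold hopFactor hopSupport
  split_ifs with hv
  · exact dependsBelow_adjBit (Set.mem_singleton u) (fun b => bif b then (1 : ℝ) else 0) G
  · congr 1
    · exact dependsBelow_adjBit (Set.mem_insert u R) (fun b => bif b then (0 : ℝ) else 1) G
    · exact dependsBelow_findIdx (fun a ha => by simp_all) (fun i => x ^ (i + 1)) G

theorem pairwiseDisjoint_hopSupport {s : Set V} {u : V} (hu : u ∉ s) (R : Finset V) :
    s.PairwiseDisjoint (hopSupport u R) := by
  intro v hv w hw hvw
  have hvu : v ≠ u := ne_of_mem_of_not_mem hv hu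
  have hwu : w ≠ u := ne_of_mem_of_not_mem hw hu
  refine disjoint_spokes hvw ?_
  split_ifs <;> simp_all

variable [Fintype V]

theorem expect_adjBit {u v : V} (huv : u ≠ v) (φ : Bool → ℝ) :
    𝔼 G, φ (adjBit G u v) = (φ false + φ true) / 2 := by
  have hflip (G : SimpleGraph V) : adjBit (symmDiff G (.edge u v)) u v = !adjBit G u v := by
    rw [Bool.eq_iff_iff]
    simp [symmDiff_def, SimpleGraph.edge_adj, huv, ← Bool.not_eq_true]
  have hinv : Function.Involutive fun G : SimpleGraph V => symmDiff G (.edge u v) :=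
    fun G => symmDiff_symmDiff_cancel_right _ _
  have hsymm : 𝔼 G, φ (adjBit G u v) = 𝔼 G, φ (!adjBit G u v) :=
    Fintype.expect_equiv hinv.toPerm _ _ fun G => by simp [hflip]
  have hsum : 𝔼 G, φ (adjBit G u v) + 𝔼 G, φ (!adjBit G u v) = φ false + φ true := by
    have hconst (G : SimpleGraph V) :
        φ (adjBit G u v) + φ (!adjBit G u v) = φ false + φ true := by
      cases adjBit G u v <;> simp [add_comm]
    simp only [← Finset.expect_add_distrib, hconst, Fintype.expect_const]
  linarith

theorem expect_pow_findIdx_le {x : ℝ} (hx₁ : 1 ≤ x) (hx₂ : x < 2) {v : V} {l : List V}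
    (hl : l.Nodup) (hv : v ∉ l) :
    𝔼 G, x ^ (l.findIdx (adjBit G · v) + 1) ≤ x / (2 - x) := by
  induction l with
  | nil =>
    simp only [List.findIdx_nil, zero_add, pow_one, Fintype.expect_const]
    exact le_div_self (by linarith) (by linarith) (by linarith)
  | cons a l ih =>
    rw [List.nodup_cons] at hl
    rw [List.mem_cons, not_or] at hv
    let rest (G : SimpleGraph V) : ℝ := x ^ (l.findIdx (adjBit G · v) + 1)
    have hstep (G : SimpleGraph V) : x ^ ((a :: l).findIdx (adjBit G · v) + 1) =
        x * (bif adjBit G a v then 1 else 0) + x * ((bif adjBit G a v then 0 else 1) * rest G) := by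
      cases h : adjBit G a v <;> simp [List.findIdx_cons, h, rest, pow_succ']
    have hindep : 𝔼 G, (bif adjBit G a v then 0 else 1) * rest G =
        (𝔼 G, bif adjBit G a v then (0 : ℝ) else 1) * 𝔼 G, rest G :=
      expect_mul_of_disjoint
        (dependsBelow_adjBit (Set.mem_singleton a) fun b => bif b then (0 : ℝ) else 1)
        (dependsBelow_findIdx (S := {b | b ∈ l}) (fun _ => id) fun i => x ^ (i + 1))
        (disjoint_spokes_self (by simpa using hl.1))
    have hne : a ≠ v := Ne.symm hv.1
    calc 𝔼 G, x ^ ((a :: l).findIdx (adjBit G · v) + 1)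
        = x * (1 / 2) + x * (1 / 2 * 𝔼 G, rest G) := by
          simp only [hstep, Finset.expect_add_distrib, ← Finset.mul_expect, hindep,
            expect_adjBit hne fun b => bif b then (1 : ℝ) else 0,
            expect_adjBit hne fun b => bif b then (0 : ℝ) else 1]
          norm_num
      _ ≤ x * (1 / 2) + x * (1 / 2 * (x / (2 - x))) := by gcongr; exact ih hl.2 hv.2
      _ = x / (2 - x) := by
          have : 2 - x ≠ 0 := by linarith
          field_simp
          ring


theorem prod_pow_hopIndex_le (x : ℝ) (hx : 0 ≤ x) (l : List V) (u : V) (G : SimpleGraph V) :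
    ∏ v ∈ Finset.univ.erase u, x ^ hopIndex (adjBit G) l u v ≤
      ∑ R ∈ (Finset.univ.erase u).powerset, ∏ v ∈ Finset.univ.erase u, hopFactor x l u R v G := by
  let R : Finset V := {v | adjBit G u v}
  have hmem (v : V) : v ∈ R ↔ adjBit G u v := by simp [R]
  have hR : R ∈ (Finset.univ.erase u).powerset := by
    simp [Finset.subset_erase, hmem, adjBit]
  have hfactor (v : V) : hopFactor x l u R v G = x ^ hopIndex (adjBit G) l u v := by
    have hfilter : l.filter (· ∈ R) = neighbours (adjBit G) l u :=
      List.filter_congr fun w _ => by rw [Bool.eq_iff_iff, decide_eq_true_eq, hmem]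
    cases h : adjBit G u v <;> simp [hopFactor, hopIndex, hfilter, hmem, h]
  simp only [← hfactor]
  exact Finset.single_le_sum (f := fun R => ∏ v ∈ Finset.univ.erase u, hopFactor x l u R v G)
    (fun R _ => Finset.prod_nonneg fun v _ => hopFactor_nonneg hx l u R v G) hR

theorem expect_hopFactor_le {x : ℝ} (hx₁ : 1 ≤ x) (hx₂ : x < 2) {l : List V} (hl : l.Nodup)
    {u v : V} (huv : u ≠ v) {R : Finset V} (hu : u ∉ R) :
    𝔼 G, hopFactor x l u R v G ≤ if v ∈ R then 1 / 2 else x / (2 - x) / 2 := by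
  split_ifs with hv
  · simp only [hopFactor, if_pos hv, expect_adjBit huv fun b => bif b then (1 : ℝ) else 0]
    norm_num
  · have hindep := expect_mul_of_disjoint
      (dependsBelow_adjBit (v := v) (Set.mem_singleton u) fun b => bif b then (0 : ℝ) else 1)
      (dependsBelow_findIdx (v := v) (l := l.filter (· ∈ R)) (S := R) (by simp)
        fun i => x ^ (i + 1))
      (disjoint_spokes_self (by simpa using hu))
    have hpow := expect_pow_findIdx_le hx₁ hx₂ (hl.filter (· ∈ R)) (v := v) (by simp [hv])
    simp only [hopFactor, if_neg hv, hindep,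
      expect_adjBit huv fun b => bif b then (0 : ℝ) else 1, cond_true, cond_false]
    linarith

theorem expect_pow_sum_hopIndex_le {x : ℝ} (hx₁ : 1 ≤ x) (hx₂ : x < 2) {l : List V}
    (hl : l.Nodup) (u : V) :
    𝔼 G, x ^ ∑ v, hopIndex (adjBit G) l u v ≤ ((2 - x)⁻¹) ^ Fintype.card V := by
  set s : Finset V := Finset.univ.erase u
  have hus (v : V) (hv : v ∈ s) : u ≠ v := (Finset.ne_of_mem_erase hv).symm
  have hcell (R : Finset V) (hR : R ∈ s.powerset) :
      𝔼 G, ∏ v ∈ s, hopFactor x l u R v G ≤ (1 / 2) ^ #R * (x / (2 - x) / 2) ^ #(s \ R) := by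
    rw [Finset.mem_powerset] at hR
    have hu : u ∉ R := fun h => hus u (hR h) rfl
    rw [expect_prod_of_pairwiseDisjoint (fun v _ => dependsBelow_hopFactor x l u R v)
      (pairwiseDisjoint_hopSupport (by simp [s]) R)]
    refine (Finset.prod_le_prod (fun v _ => Finset.expect_nonneg fun G _ =>
      hopFactor_nonneg (by linarith) l u R v G)
      fun v hv => expect_hopFactor_le hx₁ hx₂ hl (hus v hv) hu).trans_eq ?_
    rw [Finset.prod_ite, Finset.filter_mem_eq_inter, Finset.inter_eq_right.2 hR,
      Finset.filter_notMem_eq_sdiff, Finset.prod_const, Finset.prod_const]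
  have hx : x ≤ (2 - x)⁻¹ := by
    rw [← one_div, le_div_iff₀ (by linarith)]
    nlinarith [sq_nonneg (x - 1)]
  calc 𝔼 G, x ^ ∑ v, hopIndex (adjBit G) l u v
      = 𝔼 G, x * ∏ v ∈ s, x ^ hopIndex (adjBit G) l u v := by
        refine Finset.expect_congr rfl fun G _ => ?_
        rw [← Finset.prod_pow_eq_pow_sum, ← Finset.mul_prod_erase _ _ (Finset.mem_univ u),
          hopIndex_self, pow_one]
    _ ≤ 𝔼 G, x * ∑ R ∈ s.powerset, ∏ v ∈ s, hopFactor x l u R v G := by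
        gcongr with G
        exact prod_pow_hopIndex_le x (by linarith) l u G
    _ = x * ∑ R ∈ s.powerset, 𝔼 G, ∏ v ∈ s, hopFactor x l u R v G := by
        rw [← Finset.mul_expect, Finset.expect_sum_comm]
    _ ≤ x * ∑ R ∈ s.powerset, (1 / 2) ^ #R * (x / (2 - x) / 2) ^ #(s \ R) := by
        gcongr with R hR
        exact hcell R hR
    _ = x * (1 / 2 + x / (2 - x) / 2) ^ #s := by
        rw [← Finset.prod_const, Finset.prod_add]
        simp only [Finset.prod_const]
    _ = x * ((2 - x)⁻¹) ^ #s := by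
        have : 2 - x ≠ 0 := by linarith
        congr 2
        field_simp
        ring
    _ ≤ (2 - x)⁻¹ * ((2 - x)⁻¹) ^ #s := by
        have : 0 < 2 - x := by linarith
        gcongr
    _ = ((2 - x)⁻¹) ^ Fintype.card V := by
        rw [← pow_succ', Finset.card_erase_add_one (Finset.mem_univ u), Finset.card_univ]

theorem expect_not_common_neighbour {u v w : V} (huv : u ≠ v) (hwu : w ≠ u) (hwv : w ≠ v) :
    𝔼 G, (bif adjBit G u w && adjBit G v w then (0 : ℝ) else 1) = 3 / 4 := by
  let b (a : V) (G : SimpleGraph V) : ℝ := bif adjBit G a w then 1 else 0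
  have hb {a : V} (ha : w ≠ a) : 𝔼 G, b a G = 1 / 2 := by
    simp only [b, expect_adjBit ha.symm fun b => bif b then (1 : ℝ) else 0]
    norm_num
  have hindep : 𝔼 G, b u G * b v G = (𝔼 G, b u G) * 𝔼 G, b v G :=
    expect_mul_of_disjoint
      (dependsBelow_adjBit (Set.mem_singleton u) fun b => bif b then (1 : ℝ) else 0)
      (dependsBelow_adjBit (Set.mem_singleton v) fun b => bif b then (1 : ℝ) else 0)
      (disjoint_spokes_self (by simpa using huv))
  have hsub (G : SimpleGraph V) :
      (bif adjBit G u w && adjBit G v w then (0 : ℝ) else 1) = 1 - b u G * b v G := by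
    cases hu : adjBit G u w <;> cases hv : adjBit G v w <;> simp [b, hu, hv]
  simp only [hsub, Finset.expect_sub_distrib, Fintype.expect_const, hindep, hb hwu, hb hwv]
  norm_num

theorem expect_no_common_neighbour_le {u v : V} (huv : u ≠ v) :
    𝔼 G : SimpleGraph V, (if ∃ w, adjBit G u w ∧ adjBit G w v then (0 : ℝ) else 1) ≤
      (3 / 4) ^ (Fintype.card V - 2) := by
  set I : Finset V := {u, v}ᶜ
  let f (w : V) (G : SimpleGraph V) : ℝ := bif adjBit G u w && adjBit G v w then 0 else 1
  have hfnonneg (w : V) (G : SimpleGraph V) : 0 ≤ f w G := by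
    cases h : adjBit G u w && adjBit G v w <;> simp [f, h]
  have hf (w : V) (_ : w ∈ I) : DependsBelow (f w) (spokes w {u, v}) := fun G => by
    simp only [f]
    rw [adjBit_inf_spokes (by simp), adjBit_inf_spokes (by simp)]
  have hdisj : (I : Set V).PairwiseDisjoint fun w => spokes w {u, v} :=
    fun w hw w' _ hne => disjoint_spokes hne (by simp_all [I])
  calc 𝔼 G : SimpleGraph V, (if ∃ w, adjBit G u w ∧ adjBit G w v then (0 : ℝ) else 1)
      ≤ 𝔼 G, ∏ w ∈ I, f w G := by
        refine Finset.expect_le_expect fun G _ => ?_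
        split_ifs with h
        · exact Finset.prod_nonneg fun w _ => hfnonneg w G
        · refine (Finset.prod_eq_one fun w _ => ?_).ge
          have hbit : (adjBit G u w && adjBit G v w) = false := by
            rw [← Bool.not_eq_true, Bool.and_eq_true, adjBit_comm G v]
            exact fun hw => h ⟨w, hw⟩
          simp [f, hbit]
    _ = ∏ w ∈ I, 𝔼 G, f w G := expect_prod_of_pairwiseDisjoint hf hdisj
    _ = (3 / 4) ^ #I := by
        refine Finset.prod_eq_pow_card fun w hw => ?_
        simp only [I, Finset.mem_compl, Finset.mem_insert, Finset.mem_singleton, not_or] at hw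
        exact expect_not_common_neighbour huv hw.1 hw.2
    _ = (3 / 4) ^ (Fintype.card V - 2) := by
        rw [Finset.card_compl, Finset.card_pair huv]

theorem pow_le_pow_of_seven_mul_le {m n : ℕ} (h : 7 * n ≤ 4 * m) :
    (33 / 20 : ℝ) ^ n ≤ (4 / 3) ^ m := by
  refine (pow_le_pow_iff_left₀ (by positivity) (by positivity) four_ne_zero).1 ?_
  calc ((33 / 20 : ℝ) ^ n) ^ 4 = ((33 / 20) ^ 4) ^ n := pow_right_comm _ _ _
    _ ≤ ((4 / 3) ^ 7) ^ n := by gcongr; norm_num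
    _ = (4 / 3) ^ (7 * n) := (pow_mul _ _ _).symm
    _ ≤ (4 / 3) ^ (4 * m) := by gcongr; norm_num
    _ = ((4 / 3) ^ m) ^ 4 := by rw [← pow_mul, mul_comm]

theorem indicator_not_isTypical_le {l : List V} (hl : l.Nodup) (hmem : ∀ v, v ∈ l)
    (G : SimpleGraph V) :
    (if IsTypical (adjBit G) l then (0 : ℝ) else 1) ≤
      (∑ u, (4 / 3) ^ ∑ v, hopIndex (adjBit G) l u v) / (33 / 20) ^ Fintype.card V +
      ∑ u, ∑ v ∈ Finset.univ.erase u, if ∃ w, adjBit G u w ∧ adjBit G w v then (0 : ℝ) else 1 := by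
  have hpow_nonneg : 0 ≤ (∑ u, (4 / 3 : ℝ) ^ ∑ v, hopIndex (adjBit G) l u v) /
      (33 / 20) ^ Fintype.card V := by positivity
  have hfar_nonneg (u v : V) :
      0 ≤ if ∃ w, adjBit G u w ∧ adjBit G w v then (0 : ℝ) else 1 := by positivity
  have hfar_sum_nonneg := Finset.sum_nonneg fun u (_ : u ∈ Finset.univ) =>
    Finset.sum_nonneg fun v (_ : v ∈ Finset.univ.erase u) => hfar_nonneg u v
  split_ifs with htypical
  · exact add_nonneg hpow_nonneg hfar_sum_nonneg
  have huniv : l.toFinset = Finset.univ := Finset.eq_univ_of_forall fun v => by simp [hmem]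
  have hlength : l.length = Fintype.card V := by
    rw [← List.toFinset_card_of_nodup hl, huniv, Finset.card_univ]
  simp only [IsTypical, hmem, true_and, forall_const, not_forall, not_and_or, not_lt, not_or]
    at htypical
  obtain ⟨u, hlong | ⟨v, huv, hfar⟩⟩ := htypical
  · refine le_add_of_le_of_nonneg ((one_le_div (by positivity)).2 ?_) hfar_sum_nonneg
    have hseven : 7 * Fintype.card V ≤ 4 * ∑ v, hopIndex (adjBit G) l u v := by
      rw [length_routingBits, ← List.sum_toFinset _ hl, huniv, hlength] at hlong
      lia
    exact (pow_le_pow_of_seven_mul_le hseven).trans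
      (Finset.single_le_sum (f := fun u => (4 / 3 : ℝ) ^ ∑ v, hopIndex (adjBit G) l u v)
        (fun _ _ => by positivity) (Finset.mem_univ u))
  · refine le_add_of_nonneg_of_le hpow_nonneg ?_
    calc (1 : ℝ) = if ∃ w, adjBit G u w ∧ adjBit G w v then (0 : ℝ) else 1 := (if_neg hfar).symm
      _ ≤ ∑ v ∈ Finset.univ.erase u, if ∃ w, adjBit G u w ∧ adjBit G w v then (0 : ℝ) else 1 :=
        Finset.single_le_sum (fun v _ => hfar_nonneg u v) (by simpa using Ne.symm huv)
      _ ≤ _ := Finset.single_le_sum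
        (f := fun u => ∑ v ∈ Finset.univ.erase u,
          if ∃ w, adjBit G u w ∧ adjBit G w v then (0 : ℝ) else 1)
        (fun u _ => Finset.sum_nonneg fun v _ => hfar_nonneg u v) (Finset.mem_univ u)

theorem expect_not_isTypical_le {l : List V} (hl : l.Nodup) (hmem : ∀ v, v ∈ l) :
    𝔼 G : SimpleGraph V, (if IsTypical (adjBit G) l then (0 : ℝ) else 1) ≤
      Fintype.card V * (10 / 11) ^ Fintype.card V +
        Fintype.card V ^ 2 * (3 / 4) ^ (Fintype.card V - 2) := by
  set n := Fintype.card V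
  have hpow (u : V) : 𝔼 G, (4 / 3 : ℝ) ^ ∑ v, hopIndex (adjBit G) l u v ≤ (3 / 2) ^ n := by
    refine (expect_pow_sum_hopIndex_le (by norm_num) (by norm_num) hl u).trans_eq ?_
    norm_num [n]
  have hfar (u : V) : ∑ v ∈ Finset.univ.erase u, 𝔼 G : SimpleGraph V,
      (if ∃ w, adjBit G u w ∧ adjBit G w v then (0 : ℝ) else 1) ≤ n * (3 / 4) ^ (n - 2) := by
    refine (Finset.sum_le_card_nsmul _ _ _ fun v hv =>
      expect_no_common_neighbour_le (Finset.ne_of_mem_erase hv).symm).trans ?_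
    rw [nsmul_eq_mul]
    gcongr
    exact Finset.card_erase_le
  calc 𝔼 G : SimpleGraph V, (if IsTypical (adjBit G) l then (0 : ℝ) else 1)
      ≤ (∑ u, 𝔼 G, (4 / 3 : ℝ) ^ ∑ v, hopIndex (adjBit G) l u v) / (33 / 20) ^ n +
        ∑ u, ∑ v ∈ Finset.univ.erase u, 𝔼 G : SimpleGraph V,
          (if ∃ w, adjBit G u w ∧ adjBit G w v then (0 : ℝ) else 1) := by
        refine (Finset.expect_le_expect fun G _ =>
          indicator_not_isTypical_le hl hmem G).trans_eq ?_
        simp only [Finset.expect_add_distrib, ← Finset.expect_div, Finset.expect_sum_comm, n]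
    _ ≤ (∑ _u : V, (3 / 2) ^ n) / (33 / 20) ^ n + ∑ _u : V, (n : ℝ) * (3 / 4) ^ (n - 2) := by
        gcongr with u _ u
        · exact hpow u
        · exact hfar u
    _ = n * (10 / 11) ^ n + n ^ 2 * (3 / 4) ^ (n - 2) := by
        simp only [Finset.sum_const, Finset.card_univ, nsmul_eq_mul, mul_div_assoc, ← div_pow]
        norm_num [n, sq, mul_assoc]

end RandomGraph

/-! ### Random graphs are typical -/

theorem length_atypicalCodes_le (n : ℕ) : ((atypicalCodes n).length : ℝ) ≤
    2 ^ n.choose 2 * (n * (10 / 11) ^ n + n ^ 2 * (3 / 4) ^ (n - 2)) := by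
  have hlength : ((atypicalCodes n).length : ℝ) = 2 ^ n.choose 2 *
      𝔼 G : SimpleGraph (Fin n), if IsTypical (adjBit G) (List.finRange n) then (0 : ℝ) else 1 := by
    rw [atypicalCodes, length_filter_bitStrings]
    simp only [isTypical_codeAdj_graphCode]
    rw [Fintype.expect_eq_sum_div_card, card_simpleGraph_fin, Finset.card_filter]
    push_cast
    rw [mul_div_cancel₀ _ (by positivity)]
    exact Finset.sum_congr rfl fun G _ => ite_not ..
  rw [hlength]
  gcongr
  simpa using expect_not_isTypical_le (List.nodup_finRange n) List.mem_finRange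

theorem eventually_le_half_pow : ∀ᶠ n : ℕ in Filter.atTop,
    (n * (10 / 11) ^ n + n ^ 2 * (3 / 4) ^ (n - 2) : ℝ) ≤ (1 / 2) ^ (n / 16) := by
  -- `(10 / 11) / (22 / 23) = 115 / 121` and `(22 / 23) ^ 16 ≤ 1 / 2`.
  have hsmall : ∀ᶠ n : ℕ in Filter.atTop, (n ^ 2 * (115 / 121) ^ n : ℝ) ≤ 1 / 3 :=
    (tendsto_pow_const_mul_const_pow_of_abs_lt_one 2
      (by rw [abs_of_pos] <;> norm_num)).eventually (ge_mem_nhds (by norm_num))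
  filter_upwards [hsmall, Filter.eventually_ge_atTop 2] with n hn htwo
  have hone : (1 : ℝ) ≤ n := by exact_mod_cast one_le_two.trans htwo
  calc (n * (10 / 11) ^ n + n ^ 2 * (3 / 4) ^ (n - 2) : ℝ)
      = n * (10 / 11) ^ n + 16 / 9 * (n ^ 2 * (3 / 4) ^ n) := by
        rw [pow_sub₀ _ (by norm_num) htwo]
        ring
    _ ≤ n ^ 2 * (10 / 11) ^ n + 16 / 9 * (n ^ 2 * (10 / 11) ^ n) := by
        gcongr ?_ * (10 / 11) ^ n + 16 / 9 * (n ^ 2 * ?_ ^ n)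
        · exact le_self_pow₀ hone two_ne_zero
        · norm_num
    _ ≤ 3 * (n ^ 2 * (10 / 11) ^ n) := by
        have : (0 : ℝ) ≤ n ^ 2 * (10 / 11) ^ n := by positivity
        linarith
    _ = 3 * (n ^ 2 * (115 / 121) ^ n) * (22 / 23) ^ n := by
        rw [show (10 / 11 : ℝ) = 115 / 121 * (22 / 23) by norm_num, mul_pow]
        ring
    _ ≤ 1 * (22 / 23) ^ (16 * (n / 16)) := by
        gcongr ?_ * ?_
        · linarith
        · exact pow_le_pow_of_le_one (by norm_num) (by norm_num) (Nat.mul_div_le n 16)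
    _ ≤ (1 / 2) ^ (n / 16) := by
        rw [one_mul, pow_mul]
        gcongr
        norm_num

theorem eventually_isTypical_of_isRandomGraph {U : Machine} (hU : IsUniversal U) {δ : ℕ → ℝ}
    (hδ : ∀ᶠ n : ℕ in Filter.atTop, δ n ≤ n / 32) :
    ∀ᶠ n : ℕ in Filter.atTop, ∀ G : SimpleGraph (Fin n), IsRandomGraph U δ G →
      IsTypical (adjBit G) (List.finRange n) := by
  obtain ⟨c, hc⟩ := hU.exists_complexity_le
    (primrec_atypicalCodes.comp (Primrec.fst.comp Primrec.unpair)).to_comp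
  filter_upwards [hδ, eventually_le_half_pow, Filter.eventually_gt_atTop (32 * (c + 1))]
    with n hδn hratio hn G hG
  by_contra hatypical
  have hle : n / 16 ≤ n.choose 2 := by
    rw [Nat.choose_two_right, Nat.le_div_iff_mul_le two_pos]
    calc n / 16 * 2 ≤ n := by omega
      _ ≤ n * (n - 1) := Nat.le_mul_of_pos_right n (by omega)
  have hlength : (atypicalCodes n).length ≤ 2 ^ (n.choose 2 - n / 16) := by
    have hreal : ((atypicalCodes n).length : ℝ) ≤ 2 ^ (n.choose 2 - n / 16) :=
      calc ((atypicalCodes n).length : ℝ) ≤ 2 ^ n.choose 2 * (1 / 2) ^ (n / 16) := by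
            refine (length_atypicalCodes_le n).trans ?_
            gcongr
        _ = 2 ^ (n.choose 2 - n / 16) := by
            rw [one_div, inv_pow, pow_sub₀ _ two_ne_zero hle]
    exact_mod_cast hreal
  have hmem : graphCode G ∈ atypicalCodes n := by
    rw [atypicalCodes, List.mem_filter, mem_bitStrings, length_graphCode]
    simpa [isTypical_codeAdj_graphCode] using hatypical
  have hcomplexity : (complexity U (graphCode G) (Nat.pair n ⌊δ n⌋₊) : ℝ) ≤
      n.choose 2 - (n / 16 : ℕ) + c := by
    rw [← Nat.cast_sub hle]
    exact_mod_cast hc _ _ (graphCode G) (by simpa using hmem) (by simpa using hlength)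
  rw [IsRandomGraph, ← Nat.cast_choose_two] at hG
  have hdiv : (n : ℝ) ≤ 16 * (n / 16 : ℕ) + 16 := by
    exact_mod_cast (show n ≤ 16 * (n / 16) + 16 by omega)
  have hn' : (32 : ℝ) * (c + 1) < n := by exact_mod_cast hn
  linarith

theorem four_mul_size_le {n : ℕ} (hn : 24 ≤ n) : 4 * n.size ≤ n := by
  have hlt : n < 2 ^ (n / 4) :=
    calc n < 8 * (n / 8 + 1) := by omega
      _ ≤ 8 * 2 ^ (n / 8) := by gcongr; exact Nat.lt_two_pow_self
      _ = 2 ^ (n / 8 + 3) := by rw [pow_add, mul_comm]; norm_num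
      _ ≤ 2 ^ (n / 4) := by gcongr <;> omega
  calc 4 * n.size ≤ 4 * (n / 4) := by gcongr; exact Nat.size_le.2 hlt
    _ ≤ n := Nat.mul_div_le n 4

theorem eventually_le_div_of_isBigO_logb {δ : ℕ → ℝ}
    (hδ : δ =O[Filter.atTop] fun n : ℕ => Real.logb 2 n) :
    ∀ᶠ n : ℕ in Filter.atTop, δ n ≤ n / 32 := by
  have hlog : (fun n : ℕ => Real.logb 2 n) =o[Filter.atTop] fun n : ℕ => (n : ℝ) := by
    simp only [Real.logb, div_eq_inv_mul]
    exact (Real.isLittleO_log_id_atTop.comp_tendsto tendsto_natCast_atTop_atTop).const_mul_left _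
  filter_upwards [(hδ.trans_isLittleO hlog).def (show (0 : ℝ) < 1 / 32 by norm_num)] with n hn
  calc δ n ≤ ‖δ n‖ := le_abs_self _
    _ ≤ 1 / 32 * ‖(n : ℝ)‖ := hn
    _ = n / 32 := by rw [Real.norm_natCast]; ring

end CompactRouting

theorem mainTheorem1_general : ∃ D : CompactRouting.Decoder, Computable D ∧
    ∀ (E : CompactRouting.EdgeModel) (L : CompactRouting.LabelModel)
      (U : CompactRouting.Machine), CompactRouting.IsUniversal U →
    ∀ δ : ℕ → ℝ, (∀ᶠ n : ℕ in Filter.atTop, δ n ≤ n / 32) →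
    ∀ᶠ n : ℕ in Filter.atTop, ∀ G : SimpleGraph (Fin n), CompactRouting.IsRandomGraph U δ G →
      ∃ S : CompactRouting.RoutingScheme G,
        S.EdgesConform E ∧ S.LabelsConform L ∧ S.IsShortestPath D ∧
        (∀ u, S.nodeCost L u ≤ 3 * n) ∧ ∑ u, S.nodeCost L u ≤ 3 * n ^ 2 := by
  refine ⟨CompactRouting.hopDecoder, CompactRouting.computable_hopDecoder, fun E L U hU δ hδ => ?_⟩
  filter_upwards [CompactRouting.eventually_isTypical_of_isRandomGraph hU hδ,
    Filter.eventually_ge_atTop 24] with n htypical hn G hG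
  exact CompactRouting.exists_scheme_of_isTypical G E L
    (CompactRouting.four_mul_size_le hn) (htypical G hG)

theorem mainTheorem1 (E : CompactRouting.EdgeModel) (L : CompactRouting.LabelModel) :
    ∃ D : CompactRouting.Decoder, Computable D ∧
      ∀ U : CompactRouting.Machine, CompactRouting.IsUniversal U →
      ∀ δ : ℕ → ℝ, (δ =O[Filter.atTop] fun n : ℕ => Real.logb 2 (n : ℝ)) →
      ∀ᶠ n : ℕ in Filter.atTop, ∀ G : SimpleGraph (Fin n),
        CompactRouting.IsRandomGraph U δ G →
        ∃ S : CompactRouting.RoutingScheme G,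
          S.EdgesConform E ∧ S.LabelsConform L ∧ S.IsShortestPath D ∧
          (∀ u, S.nodeCost L u ≤ 3 * n) ∧ ∑ u, S.nodeCost L u ≤ 3 * n ^ 2 := by
  obtain ⟨D, hD, hscheme⟩ := mainTheorem1_general
  exact ⟨D, hD, fun U hU δ hδ => hscheme E L U hU δ
    (CompactRouting.eventually_le_div_of_isBigO_logb hδ)⟩
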